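/- Let $(\Omega,\Sigma,\mu)$ be a $\sigma$-finite measure space and let $P\colon\Omega\to(0,\infty]$ be measurable (a variable exponent). For $p\in(0,\infty)$ put $\Phi_p(t)=t^p$, and put $\Phi_\infty(t)=0$ if $0\le t\le 1$ and $\Phi_\infty(t)=\infty$ if $t>1$. For measurable $f\colon\Omega\to\mathbb F$ (with $\mathbb F=\mathbb R$ or $\mathbb C$) let $\rho_P(f)=\int_\Omega \Phi_{P(\omega)}(|f(\omega)|)\,d\mu(\omega)$. The variable exponent Lebesgue space $L_P=L_P(\mu)$ consists of all (classes modulo equality a.e. of) measurable $f$ with $\rho_P(tf)<\infty$ for some $t\in(0,\infty)$, and is equipped with $\|f\|_P=\inf\{t\in(0,\infty):\rho_P(f/t)<1\}$. The essential range $R(P)\subseteq[0,\infty]$ of $P$ is the support of the image measure of $\mu$ under $P$, that is, the set of all $p\in[0,\infty]$ such that $\mu(P^{-1}(V))>0$ for every neighbourhood $V$ of $p$; let $P^-=\min R(P)$ (with $P^-=\infty$ if $\mu=0$). Assume that $P^->0$, and let $q\in(0,\infty]$. A sequence $(x_n)_{n=1}^\infty$ in $L_P$ is disjointly supported if $\mu(\{x_n\ne0\}\cap\{x_m\neq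 0\})=0$ whenever $n\ne m$, and it is equivalent to the unit vector system $(e_n)_{n=1}^\infty$ of $\ell_q$ if there are constants $c,C\in(0,\infty)$ such that $$c\,\Big\|\sum_n a_n e_n\Big\|_{\ell_q}\le\Big\|\sum_n a_n x_n\Big\|_{P}\le C\,\Big\|\sum_n a_n e_n\Big\|_{\ell_q}$$ for every finitely supported scalar sequence $(a_n)_{n=1}^\infty$. (i) If $L_P$ has a disjointly supported sequence equivalent to the unit vector system of $\ell_q$, then $q\in R(P)$. (ii) If moreover $\mu$ is nonatomic (every measurable set of positive measure is a disjoint union of two measurable sets of positive measure), then $L_P$ has a disjointly supported sequence equivalent to the unit vector system of $\ell_q$ if and only if $q\in R(P)$. -/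

import Mathlib

open MeasureTheory Function
open scoped ENNReal NNReal

noncomputable section

namespace VarLebesgue

/-- A variable exponent on `Ω`: a measurable function `P : Ω → (0, ∞]`. -/
structure VariableExponent (Ω : Type*) [MeasurableSpace Ω] where
  toFun : Ω → ℝ≥0∞
  measurable : Measurable toFun
  pos : ∀ ω, 0 < toFun ω

/-- The potential function `Φ_p(t) = t ^ p` for `p ∈ (0, ∞)`, with `Φ_∞ = ∞ · χ_(1, ∞]`. -/
def potential (p t : ℝ≥0∞) : ℝ≥0∞ :=
  if p = ∞ then (if t ≤ 1 then 0 else ∞) else t ^ p.toReal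

theorem potential_zero {p : ℝ≥0∞} (hp : 0 < p) : potential p 0 = 0 := by
  unfold potential
  split_ifs with h h'
  · rfl
  · simp at h'
  · exact ENNReal.zero_rpow_of_pos (ENNReal.toReal_pos hp.ne' h)

theorem potential_mono (p : ℝ≥0∞) : Monotone (potential p) := by
  intro s t hst
  unfold potential
  split_ifs with h h1 h2 h2
  · exact le_rfl
  · exact zero_le
  · exact absurd (hst.trans h2) h1
  · exact le_rfl
  · exact ENNReal.rpow_le_rpow hst ENNReal.toReal_nonneg

theorem potential_measurable : Measurable (fun z : ℝ≥0∞ × ℝ≥0∞ => potential z.1 z.2) := by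
  unfold potential
  refine Measurable.ite (measurable_fst (measurableSet_singleton _)) ?_ ?_
  · exact Measurable.ite (measurable_snd measurableSet_Iic) measurable_const measurable_const
  · exact measurable_snd.pow measurable_fst.ennreal_toReal

variable {Ω : Type*} [MeasurableSpace Ω]

/-- The modular `ρ_P(f) = ∫ Φ_{P(ω)}(f(ω)) dμ(ω)` of a function `f : Ω → [0, ∞]`. -/
def modular (P : VariableExponent Ω) (μ : Measure Ω) (f : Ω → ℝ≥0∞) : ℝ≥0∞ :=
  ∫⁻ ω, potential (P.toFun ω) (f ω) ∂μ

/-- The Luxemburg gauge `inf {t ∈ (0, ∞) : ρ_P(f / t) < 1}` of a function `f : Ω → [0, ∞]`. -/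
def luxemburg (P : VariableExponent Ω) (μ : Measure Ω) (f : Ω → ℝ≥0∞) : ℝ≥0∞ :=
  sInf {t : ℝ≥0∞ | 0 < t ∧ t < ∞ ∧ modular P μ (fun ω => f ω / t) < 1}

/-- The essential range `R(P)`: the support of the image measure `P(μ)` on `[0, ∞]`. -/
def essentialRange (P : VariableExponent Ω) (μ : Measure Ω) : Set ℝ≥0∞ :=
  (μ.map P.toFun).support

/-- `P⁻`, the least element of the essential range. -/
def lowerExponent (P : VariableExponent Ω) (μ : Measure Ω) : ℝ≥0∞ :=
  sInf (essentialRange P μ)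

theorem modular_mono (P : VariableExponent Ω) (μ : Measure Ω) {f g : Ω → ℝ≥0∞}
    (h : ∀ᵐ ω ∂μ, f ω ≤ g ω) : modular P μ f ≤ modular P μ g :=
  lintegral_mono_ae (h.mono fun _ hω => potential_mono _ hω)

theorem modular_sup_le (P : VariableExponent Ω) (μ : Measure Ω) {f g : Ω → ℝ≥0∞}
    (hf : AEMeasurable f μ) :
    modular P μ (fun ω => max (f ω) (g ω)) ≤ modular P μ f + modular P μ g := by
  have hm : AEMeasurable (fun ω => potential (P.toFun ω) (f ω)) μ :=
    potential_measurable.comp_aemeasurable (P.measurable.aemeasurable.prodMk hf)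
  unfold modular
  rw [← lintegral_add_left' hm]
  refine lintegral_mono fun ω => ?_
  rcases le_total (f ω) (g ω) with h | h
  · simp only [max_eq_right h]
    exact le_add_self
  · simp only [max_eq_left h]
    exact le_self_add

/-- The variable exponent Lebesgue space `L_P(μ)`: all classes of scalar measurable functions
`f` with `ρ_P(t |f|) < ∞` for some `t ∈ (0, ∞)`. -/
def VarLp (𝕜 : Type*) [RCLike 𝕜] (P : VariableExponent Ω) (μ : Measure Ω) :
    Submodule 𝕜 (Ω →ₘ[μ] 𝕜) where
  carrier := {f | ∃ t : ℝ≥0, 0 < t ∧ modular P μ (fun ω => (t : ℝ≥0∞) * ‖f ω‖ₑ) < ∞}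
  zero_mem' := by
    refine ⟨1, one_pos, ?_⟩
    have h : ∀ᵐ ω ∂μ, ((1 : ℝ≥0) : ℝ≥0∞) * ‖(0 : Ω →ₘ[μ] 𝕜) ω‖ₑ ≤ 0 := by
      filter_upwards [AEEqFun.coeFn_zero (μ := μ) (β := 𝕜) (α := Ω)] with ω hω
      simp [hω]
    refine (modular_mono P μ h).trans_lt ?_
    simp [modular, potential_zero (P.pos _)]
  add_mem' := by
    rintro f g ⟨s, hs, hf⟩ ⟨t, ht, hg⟩
    refine ⟨min s t / 2, by positivity, ?_⟩
    have hm : AEMeasurable (fun ω => (s : ℝ≥0∞) * ‖f ω‖ₑ) μ :=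
      f.aestronglyMeasurable.enorm.const_mul _
    refine lt_of_le_of_lt (modular_mono P μ ?_)
      ((modular_sup_le P μ (g := fun ω => (t : ℝ≥0∞) * ‖g ω‖ₑ) hm).trans_lt
        (ENNReal.add_lt_top.2 ⟨hf, hg⟩))
    filter_upwards [AEEqFun.coeFn_add f g] with ω hω
    rw [hω, Pi.add_apply]
    have key : (min s t / 2) * ‖f ω + g ω‖₊ ≤ max (s * ‖f ω‖₊) (t * ‖g ω‖₊) := by
      have h1 : min s t * ‖f ω‖₊ ≤ max (s * ‖f ω‖₊) (t * ‖g ω‖₊) :=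
        (mul_le_mul_left (min_le_left _ _) _).trans (le_max_left _ _)
      have h2 : min s t * ‖g ω‖₊ ≤ max (s * ‖f ω‖₊) (t * ‖g ω‖₊) :=
        (mul_le_mul_left (min_le_right _ _) _).trans (le_max_right _ _)
      calc (min s t / 2) * ‖f ω + g ω‖₊ ≤ (min s t / 2) * (‖f ω‖₊ + ‖g ω‖₊) := by
            gcongr; exact nnnorm_add_le _ _
        _ = (min s t * ‖f ω‖₊ + min s t * ‖g ω‖₊) / 2 := by ring
        _ ≤ (max (s * ‖f ω‖₊) (t * ‖g ω‖₊) + max (s * ‖f ω‖₊) (t * ‖g ω‖₊)) / 2 := by gcongr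
        _ = max (s * ‖f ω‖₊) (t * ‖g ω‖₊) := by
            rw [← two_mul]
            exact mul_div_cancel_left₀ _ two_ne_zero
    simp only [enorm_eq_nnnorm]
    exact_mod_cast key
  smul_mem' := by
    rintro c f ⟨t, ht, hf⟩
    refine ⟨t / (‖c‖₊ + 1), by positivity, ?_⟩
    refine lt_of_le_of_lt (modular_mono P μ ?_) hf
    filter_upwards [AEEqFun.coeFn_smul c f] with ω hω
    rw [hω, Pi.smul_apply]
    have key : t / (‖c‖₊ + 1) * ‖c • f ω‖₊ ≤ t * ‖f ω‖₊ := by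
      rw [nnnorm_smul, ← mul_assoc]
      gcongr
      rw [div_mul_eq_mul_div]
      refine div_le_of_le_mul₀ (by positivity) (by positivity) ?_
      gcongr
      exact le_self_add
    simp only [enorm_eq_nnnorm]
    exact_mod_cast key

/-- The quasi-norm `‖f‖_P = inf {t ∈ (0, ∞) : ρ_P(|f| / t) < 1}` of `L_P(μ)`. -/
instance VarLp.instNorm (𝕜 : Type*) [RCLike 𝕜] (P : VariableExponent Ω) (μ : Measure Ω) :
    Norm (VarLp 𝕜 P μ) where
  norm f := (luxemburg P μ fun ω => ‖(f : Ω →ₘ[μ] 𝕜) ω‖ₑ).toReal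

/-- If `P⁻ > 0`, the Luxemburg gauge is finite on `L_P(μ)`. -/
theorem luxemburg_lt_top {𝕜 : Type*} [RCLike 𝕜] {P : VariableExponent Ω} {μ : Measure Ω}
    (hP : 0 < lowerExponent P μ) (f : VarLp 𝕜 P μ) :
    (luxemburg P μ fun ω => ‖(f : Ω →ₘ[μ] 𝕜) ω‖ₑ) < ∞ := by
  obtain ⟨f, t, ht, hf⟩ := f
  obtain ⟨r, hr0, hr⟩ := ENNReal.lt_iff_exists_nnreal_btwn.1 hP
  have hr0' : 0 < r := by exact_mod_cast hr0
  have hae : ∀ᵐ ω ∂μ, (r : ℝ≥0∞) ≤ P.toFun ω := by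
    have h1 : ∀ᵐ p ∂(μ.map P.toFun), p ∈ (μ.map P.toFun).support :=
      Measure.support_mem_ae
    filter_upwards [ae_of_ae_map P.measurable.aemeasurable h1] with ω hω
    exact hr.le.trans (sInf_le hω)
  set A := modular P μ (fun ω => (t : ℝ≥0∞) * ‖f ω‖ₑ) with hA
  obtain ⟨s, hs0, hs1, hs⟩ : ∃ s : ℝ≥0, 0 < s ∧ s ≤ 1 ∧ s ^ (r : ℝ) * A.toNNReal < 1 := by
    have hlim : Filter.Tendsto (fun s : ℝ≥0 => s ^ (r : ℝ) * A.toNNReal) (nhds 0) (nhds 0) := by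
      have h := ((NNReal.continuous_rpow_const (y := (r : ℝ)) r.coe_nonneg).tendsto 0).mul_const A.toNNReal
      rwa [NNReal.zero_rpow (by exact_mod_cast hr0'.ne'), zero_mul] at h
    have h1 := hlim.eventually (gt_mem_nhds (zero_lt_one (α := ℝ≥0)))
    have h2 : ∀ᶠ s : ℝ≥0 in nhds 0, s < 1 := gt_mem_nhds one_pos
    obtain ⟨s, hs, hs0⟩ := (((h1.and h2).filter_mono nhdsWithin_le_nhds).and
      (self_mem_nhdsWithin (s := Set.Ioi (0 : ℝ≥0)))).exists
    exact ⟨s, hs0, hs.2.le, hs.1⟩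
  have hst : 0 < s * t := mul_pos hs0 ht
  refine lt_of_le_of_lt (sInf_le (a := (((s * t)⁻¹ : ℝ≥0) : ℝ≥0∞)) ⟨?_, ENNReal.coe_lt_top, ?_⟩)
    ENNReal.coe_lt_top
  · exact_mod_cast inv_pos.2 hst
  have hle : modular P μ (fun ω => ‖f ω‖ₑ / (((s * t)⁻¹ : ℝ≥0) : ℝ≥0∞)) ≤
      (s : ℝ≥0∞) ^ (r : ℝ) * A := by
    rw [hA, modular, modular, ← lintegral_const_mul' _ _
      (ENNReal.rpow_ne_top_of_nonneg r.coe_nonneg ENNReal.coe_ne_top)]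
    refine lintegral_mono_ae ?_
    filter_upwards [hae] with ω hω
    have e : ‖f ω‖ₑ / (((s * t)⁻¹ : ℝ≥0) : ℝ≥0∞) = s * (t * ‖f ω‖ₑ) := by
      rw [ENNReal.coe_inv hst.ne', div_eq_mul_inv, inv_inv, ENNReal.coe_mul]; ring
    rw [e]
    have hs1' : (s : ℝ≥0∞) ≤ 1 := by exact_mod_cast hs1
    unfold potential
    split_ifs with h h1 h2 h2
    · exact zero_le
    · exact zero_le
    · exact absurd ((mul_le_of_le_one_left zero_le hs1').trans h2) h1
    · rw [ENNReal.mul_top]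
      exact (ENNReal.rpow_pos (by exact_mod_cast hs0) ENNReal.coe_ne_top).ne'
    · rw [ENNReal.mul_rpow_of_nonneg _ _ ENNReal.toReal_nonneg]
      gcongr ?_ * _
      refine ENNReal.rpow_le_rpow_of_exponent_ge hs1' ?_
      simpa using ENNReal.toReal_mono h hω
  refine hle.trans_lt ?_
  rw [← ENNReal.coe_toNNReal hf.ne, ← ENNReal.coe_rpow_of_nonneg _ r.coe_nonneg]
  exact_mod_cast hs

/-- A sequence in `L_P(μ)` is disjointly supported if its terms have pairwise disjoint supports,
up to null sets. -/
def DisjointlySupported {𝕜 : Type*} [RCLike 𝕜] {P : VariableExponent Ω} {μ : Measure Ω}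
    (x : ℕ → VarLp 𝕜 P μ) : Prop :=
  Pairwise (AEDisjoint μ on fun n => support ((x n : Ω →ₘ[μ] 𝕜) : Ω → 𝕜))

/-- Two sequences in quasi-normed spaces are equivalent if the norms of their finite linear
combinations with the same coefficients are comparable, uniformly in the coefficients. -/
def EquivalentSequences (𝕜 : Type*) [RCLike 𝕜] {X Y : Type*} [AddCommGroup X] [Module 𝕜 X] [Norm X]
    [AddCommGroup Y] [Module 𝕜 Y] [Norm Y] (x : ℕ → X) (y : ℕ → Y) : Prop :=
  ∃ c C : ℝ, 0 < c ∧ 0 < C ∧ ∀ a : ℕ →₀ 𝕜,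
    c * ‖a.sum fun n t => t • y n‖ ≤ ‖a.sum fun n t => t • x n‖ ∧
      ‖a.sum fun n t => t • x n‖ ≤ C * ‖a.sum fun n t => t • y n‖

/-- The unit vector system of `ℓ_q`. -/
def unitVector (𝕜 : Type*) [RCLike 𝕜] (q : ℝ≥0∞) (n : ℕ) : lp (fun _ : ℕ => 𝕜) q :=
  lp.single q n (1 : 𝕜)

/-- An atom: a measurable set of positive measure that cannot be split into two measurable
sets of positive measure. -/
def IsMeasureAtom (μ : Measure Ω) (A : Set Ω) : Prop :=
  MeasurableSet A ∧ 0 < μ A ∧ ∀ B ⊆ A, MeasurableSet B → μ B = 0 ∨ μ (A \ B) = 0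

/-- A measure is nonatomic if it has no atoms. -/
def IsNonatomic (μ : Measure Ω) : Prop :=
  ∀ A, ¬ IsMeasureAtom μ A

end VarLebesgue

end

/-! Two facts carry the proof. The modular is additive over disjoint sums
(`DisjointlySupported.modular_sum`), and shrinking the argument by a factor `θ ≤ 1` multiplies it by
at most `θ ^ r` where `P ≥ r` and by at least `θ ^ r` where `P ≤ r`.

Necessity: if `q` is not in the essential range, then a.e. either `P ≤ p` with `p < q` or `P ≥ p₂`
with `p₂ > q`. Only sums of `N` basis vectors, of norm `N ^ (1 / q)`, are compared. On `{P ≤ q}` the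
terms must become small: `N` terms that are not small there would have a sum of norm at least `δ N ^
(1 / p)`, more than `C N ^ (1 / q)` for large `N` (`finite_setOf_one_le_modular`). If `q = ∞` this
contradicts `‖x n‖ ≥ c`. Otherwise `N` terms negligible on `{P ≤ q}` have a sum of norm `O(N ^ (1 /
p₂))` (`norm_sum_le_of_modular_split`), which falls below `c N ^ (1 / q)`.

Sufficiency: nonatomicity gives disjoint sets `E n` on which `P` tends to `q` so fast that `Φ_P`
differs from `Φ_q` by at most `2⁻ⁿ / 8` on `[0, 1 / 2]`. For the blocks `μ(E n) ^ (-1 / P)` on `E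
n`, the modular of a combination is a sum of averages of `Φ_P`, hence within `1 / 4` of the `ℓ_q`
modular as long as all arguments stay in `[0, 1 / 2]`. This makes the gauges comparable. -/

namespace VarLebesgue

open Filter Topology

/-! ### Scaling of the potential. -/

section Potential

/-- The exponent `p = ∞` is allowed; `θ ≠ 0` keeps `θ ^ r * ∞ = ∞` there. -/
theorem potential_mul_le {p θ t : ℝ≥0∞} {r : ℝ} (hp : ENNReal.ofReal r ≤ p)
    (hθ0 : θ ≠ 0) (hθ : θ ≤ 1) : potential p (θ * t) ≤ θ ^ r * potential p t := by
  have hθt : θ ≠ ∞ := (hθ.trans_lt ENNReal.one_lt_top).ne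
  unfold potential
  split_ifs with h h1 h2 h2
  · exact zero_le
  · exact zero_le
  · exact absurd ((mul_le_of_le_one_left zero_le hθ).trans h2) h1
  · rw [ENNReal.mul_top]
    exact (ENNReal.rpow_pos (pos_iff_ne_zero.2 hθ0) hθt).ne'
  · rw [ENNReal.mul_rpow_of_nonneg _ _ ENNReal.toReal_nonneg]
    gcongr ?_ * _
    exact ENNReal.rpow_le_rpow_of_exponent_ge hθ ((ENNReal.ofReal_le_iff_le_toReal h).1 hp)

theorem le_potential_mul {p θ t : ℝ≥0∞} {r : ℝ} (hr : 0 ≤ r) (hp : p ≤ ENNReal.ofReal r)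
    (hθ : θ ≤ 1) : θ ^ r * potential p t ≤ potential p (θ * t) := by
  have h : p ≠ ∞ := (hp.trans_lt ENNReal.ofReal_lt_top).ne
  rw [potential, potential, if_neg h, if_neg h,
    ENNReal.mul_rpow_of_nonneg _ _ ENNReal.toReal_nonneg]
  gcongr ?_ * _
  exact ENNReal.rpow_le_rpow_of_exponent_ge hθ (ENNReal.toReal_le_of_le_ofReal hr hp)

theorem potential_enorm_sum_div {𝕜 : Type*} [RCLike 𝕜] {p : ℝ≥0∞} (hp : 0 < p) (s : Finset ℕ)
    (b : ℕ → 𝕜) (hb : ∀ n m, n ≠ m → b n = 0 ∨ b m = 0) (t : ℝ≥0∞) :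
    potential p (‖∑ n ∈ s, b n‖ₑ / t) = ∑ n ∈ s, potential p (‖b n‖ₑ / t) := by
  by_cases h : ∃ n ∈ s, b n ≠ 0
  · obtain ⟨n, hn, hbn⟩ := h
    have hz : ∀ m ∈ s, m ≠ n → b m = 0 := fun m _ hmn => (hb m n hmn).resolve_right hbn
    rw [Finset.sum_eq_single_of_mem n hn hz, Finset.sum_eq_single_of_mem n hn]
    intro m hm hmn
    simp [hz m hm hmn, potential_zero hp]
  · push Not at h
    rw [Finset.sum_eq_zero h, Finset.sum_eq_zero]
    · simp [potential_zero hp]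
    · intro n hn
      simp [h n hn, potential_zero hp]

end Potential

variable {𝕜 : Type*} [RCLike 𝕜] {Ω : Type*} [MeasurableSpace Ω] {μ ν : Measure Ω}
  {P : VariableExponent Ω}

/-! ### Scaling of the modular. -/

section Modular

theorem modular_mono_measure (h : ν ≤ μ) (f : Ω → ℝ≥0∞) : modular P ν f ≤ modular P μ f :=
  lintegral_mono' h le_rfl

theorem div_ofReal_eq {δ δ' : ℝ} (hδ : 0 < δ) (hδ' : 0 < δ') (y : ℝ≥0∞) :
    y / ENNReal.ofReal δ' = ENNReal.ofReal (δ / δ') * (y / ENNReal.ofReal δ) := by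
  have h0 : ENNReal.ofReal δ ≠ 0 := by simpa using hδ
  rw [ENNReal.ofReal_div_of_pos hδ', div_eq_mul_inv, div_eq_mul_inv, div_eq_mul_inv]
  calc y * (ENNReal.ofReal δ')⁻¹
      = (ENNReal.ofReal δ * (ENNReal.ofReal δ)⁻¹) * (y * (ENNReal.ofReal δ')⁻¹) := by
        rw [ENNReal.mul_inv_cancel h0 ENNReal.ofReal_ne_top, one_mul]
    _ = _ := by ring

/-- The measure `ν` is kept separate from `μ` so that this applies to restrictions of `μ` to regions
where `P` is bounded on one side. -/
theorem modular_div_le {r δ δ' : ℝ} (hr : 0 ≤ r) (hP : ∀ᵐ ω ∂ν, ENNReal.ofReal r ≤ P.toFun ω)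
    (hδ : 0 < δ) (hδδ' : δ ≤ δ') (f : Ω → ℝ≥0∞) :
    modular P ν (fun ω => f ω / ENNReal.ofReal δ') ≤
      ENNReal.ofReal ((δ / δ') ^ r) * modular P ν (fun ω => f ω / ENNReal.ofReal δ) := by
  have hδ' := hδ.trans_le hδδ'
  rw [modular, modular, ← lintegral_const_mul' _ _ ENNReal.ofReal_ne_top]
  refine lintegral_mono_ae ?_
  filter_upwards [hP] with ω hω
  rw [div_ofReal_eq hδ hδ', ← ENNReal.ofReal_rpow_of_nonneg (by positivity) hr]
  refine potential_mul_le hω ?_ ?_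
  · simpa using div_pos hδ hδ'
  · simpa using (div_le_one hδ').2 hδδ'

theorem le_modular_div {r δ δ' : ℝ} (hr : 0 ≤ r) (hP : ∀ᵐ ω ∂ν, P.toFun ω ≤ ENNReal.ofReal r)
    (hδ : 0 < δ) (hδδ' : δ ≤ δ') (f : Ω → ℝ≥0∞) :
    ENNReal.ofReal ((δ / δ') ^ r) * modular P ν (fun ω => f ω / ENNReal.ofReal δ) ≤
      modular P ν (fun ω => f ω / ENNReal.ofReal δ') := by
  have hδ' := hδ.trans_le hδδ'
  rw [modular, modular, ← lintegral_const_mul' _ _ ENNReal.ofReal_ne_top]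
  refine lintegral_mono_ae ?_
  filter_upwards [hP] with ω hω
  rw [div_ofReal_eq hδ hδ', ← ENNReal.ofReal_rpow_of_nonneg (by positivity) hr]
  refine le_potential_mul hr hω ?_
  simpa using (div_le_one hδ').2 hδδ'

theorem ae_lowerExponent_le (P : VariableExponent Ω) (μ : Measure Ω) :
    ∀ᵐ ω ∂μ, lowerExponent P μ ≤ P.toFun ω := by
  have h1 : ∀ᵐ p ∂(μ.map P.toFun), p ∈ (μ.map P.toFun).support := Measure.support_mem_ae
  filter_upwards [ae_of_ae_map P.measurable.aemeasurable h1] with ω hω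
  exact sInf_le hω

theorem exists_pos_ae_ofReal_le (hP : 0 < lowerExponent P μ) :
    ∃ r : ℝ, 0 < r ∧ ∀ᵐ ω ∂μ, ENNReal.ofReal r ≤ P.toFun ω := by
  obtain ⟨r, hr0, hr⟩ := ENNReal.lt_iff_exists_nnreal_btwn.1 hP
  refine ⟨r, by exact_mod_cast hr0, ?_⟩
  filter_upwards [ae_lowerExponent_le P μ] with ω hω
  simpa using hr.le.trans hω

end Modular

/-! ### Passing between norm and modular. -/

section Norm

theorem VarLp.norm_def (f : VarLp 𝕜 P μ) :
    ‖f‖ = (luxemburg P μ fun ω => ‖(f : Ω →ₘ[μ] 𝕜) ω‖ₑ).toReal := rfl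

/-- Positivity of `P⁻` makes the gauge finite, so that `toReal` does not send it from `∞` to `0`. -/
theorem modular_lt_one_of_norm_lt (hP : 0 < lowerExponent P μ) (f : VarLp 𝕜 P μ) {t : ℝ}
    (h : ‖f‖ < t) :
    modular P μ (fun ω => ‖(f : Ω →ₘ[μ] 𝕜) ω‖ₑ / ENNReal.ofReal t) < 1 := by
  rw [VarLp.norm_def, ← ENNReal.lt_ofReal_iff_toReal_lt (luxemburg_lt_top hP f).ne, luxemburg,
    sInf_lt_iff] at h
  obtain ⟨s, ⟨-, -, hs⟩, hst⟩ := h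
  refine lt_of_le_of_lt (modular_mono P μ (Eventually.of_forall fun ω => ?_)) hs
  gcongr

theorem norm_le_of_modular_lt_one (f : VarLp 𝕜 P μ) {t : ℝ} (ht : 0 < t)
    (h : modular P μ (fun ω => ‖(f : Ω →ₘ[μ] 𝕜) ω‖ₑ / ENNReal.ofReal t) < 1) : ‖f‖ ≤ t := by
  rw [VarLp.norm_def]
  exact ENNReal.toReal_le_of_le_ofReal ht.le
    (sInf_le ⟨ENNReal.ofReal_pos.2 ht, ENNReal.ofReal_lt_top, h⟩)

end Norm

/-! ### Modulars of disjoint sums. -/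

section DisjointSums

theorem coeFn_finset_sum_smul (x : ℕ → VarLp 𝕜 P μ) (b : ℕ → 𝕜) (s : Finset ℕ) :
    ∀ᵐ ω ∂μ, ((∑ n ∈ s, b n • x n : VarLp 𝕜 P μ) : Ω →ₘ[μ] 𝕜) ω =
      ∑ n ∈ s, b n • (x n : Ω →ₘ[μ] 𝕜) ω := by
  induction s using Finset.induction_on with
  | empty =>
    filter_upwards [AEEqFun.coeFn_zero (μ := μ) (β := 𝕜) (α := Ω)] with ω hω
    simpa using hω
  | insert n s hn ih =>
    rw [Finset.sum_insert hn, Submodule.coe_add, Submodule.coe_smul]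
    filter_upwards [ih, AEEqFun.coeFn_add (b n • (x n : Ω →ₘ[μ] 𝕜)) (∑ n ∈ s, b n • x n : VarLp 𝕜 P μ),
      AEEqFun.coeFn_smul (b n) (x n : Ω →ₘ[μ] 𝕜)] with ω h1 h2 h3
    rw [h2, Pi.add_apply, h1, h3, Finset.sum_insert hn, Pi.smul_apply]

theorem DisjointlySupported.ae_eq_zero_or {x : ℕ → VarLp 𝕜 P μ} (hx : DisjointlySupported x) :
    ∀ᵐ ω ∂μ, ∀ n m, n ≠ m → (x n : Ω →ₘ[μ] 𝕜) ω = 0 ∨ (x m : Ω →ₘ[μ] 𝕜) ω = 0 := by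
  rw [ae_all_iff]; intro n
  rw [ae_all_iff]; intro m
  by_cases hnm : n = m
  · exact Eventually.of_forall fun _ h => absurd hnm h
  · have h : μ (_ ∩ _) = 0 := hx hnm
    filter_upwards [measure_eq_zero_iff_ae_notMem.1 h] with ω hω _
    simp only [Set.mem_inter_iff, mem_support] at hω
    tauto

/-- The modular is additive over linear combinations of a disjointly supported sequence. -/
theorem DisjointlySupported.modular_sum {x : ℕ → VarLp 𝕜 P μ} (hx : DisjointlySupported x)
    (hν : ν ≪ μ) (s : Finset ℕ) (b : ℕ → 𝕜) (t : ℝ≥0∞) :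
    modular P ν (fun ω => ‖((∑ n ∈ s, b n • x n : VarLp 𝕜 P μ) : Ω →ₘ[μ] 𝕜) ω‖ₑ / t) =
      ∑ n ∈ s, modular P ν (fun ω => ‖b n • (x n : Ω →ₘ[μ] 𝕜) ω‖ₑ / t) := by
  unfold modular
  rw [← lintegral_finsetSum']
  · refine lintegral_congr_ae ?_
    filter_upwards [hν.ae_le (coeFn_finset_sum_smul x b s), hν.ae_le hx.ae_eq_zero_or] with ω h1 h2
    rw [h1, potential_enorm_sum_div (P.pos ω)]
    intro n m hnm
    rcases h2 n m hnm with h | h <;> simp [h]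
  · intro n _
    refine potential_measurable.comp_aemeasurable (P.measurable.aemeasurable.prodMk ?_)
    exact (((x n : Ω →ₘ[μ] 𝕜).aestronglyMeasurable.mono_ac hν).const_smul (b n)).enorm.div_const t

theorem DisjointlySupported.modular_sum_one {x : ℕ → VarLp 𝕜 P μ} (hx : DisjointlySupported x)
    (hν : ν ≪ μ) (s : Finset ℕ) (t : ℝ≥0∞) :
    modular P ν (fun ω => ‖((∑ n ∈ s, x n : VarLp 𝕜 P μ) : Ω →ₘ[μ] 𝕜) ω‖ₑ / t) =
      ∑ n ∈ s, modular P ν (fun ω => ‖(x n : Ω →ₘ[μ] 𝕜) ω‖ₑ / t) := by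
  simpa using hx.modular_sum hν s (fun _ => 1) t

end DisjointSums

/-! ### Norms in `ℓ_q`. -/

section UnitVectors

theorem sum_indicator_one_smul {Z : Type*} [AddCommGroup Z] [Module 𝕜 Z] (s : Finset ℕ)
    (z : ℕ → Z) :
    ((Finsupp.indicator s fun _ _ => (1 : 𝕜)).sum fun n t => t • z n) = ∑ n ∈ s, z n := by
  rw [Finsupp.sum_of_support_subset _ (Finsupp.support_indicator_subset _ _) _ (by simp)]
  exact Finset.sum_congr rfl fun n hn => by rw [Finsupp.indicator_of_mem hn, one_smul]

theorem EquivalentSequences.exists_finset_sum_bounds {X Y : Type*} [AddCommGroup X] [Module 𝕜 X]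
    [Norm X] [AddCommGroup Y] [Module 𝕜 Y] [Norm Y] {x : ℕ → X} {y : ℕ → Y}
    (h : EquivalentSequences 𝕜 x y) :
    ∃ c C : ℝ, 0 < c ∧ 0 < C ∧ ∀ s : Finset ℕ, c * ‖∑ n ∈ s, y n‖ ≤ ‖∑ n ∈ s, x n‖ ∧
      ‖∑ n ∈ s, x n‖ ≤ C * ‖∑ n ∈ s, y n‖ := by
  obtain ⟨c, C, hc, hC, h⟩ := h
  refine ⟨c, C, hc, hC, fun s => ?_⟩
  simpa only [sum_indicator_one_smul] using h (Finsupp.indicator s fun _ _ => (1 : 𝕜))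

variable {q : ℝ≥0∞}

theorem smul_unitVector (b : 𝕜) (n : ℕ) : b • unitVector 𝕜 q n = lp.single q n b := by
  rw [unitVector, ← lp.single_smul, smul_eq_mul, mul_one]

theorem norm_sum_smul_unitVector_rpow (hq : 0 < q) (hq' : q ≠ ∞) (s : Finset ℕ) (b : ℕ → 𝕜) :
    ‖∑ n ∈ s, b n • unitVector 𝕜 q n‖ ^ q.toReal = ∑ n ∈ s, ‖b n‖ ^ q.toReal := by
  simp only [smul_unitVector]
  exact lp.norm_sum_single (ENNReal.toReal_pos hq.ne' hq') b s

theorem sum_smul_unitVector_apply (s : Finset ℕ) (b : ℕ → 𝕜) (n : ℕ) :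
    (∑ n ∈ s, b n • unitVector 𝕜 q n : lp (fun _ : ℕ => 𝕜) q) n = if n ∈ s then b n else 0 := by
  simp only [smul_unitVector]
  rw [lp.coeFn_sum, Finset.sum_apply]
  simp [lp.single_apply, Pi.single_apply]

theorem norm_le_norm_sum_smul_unitVector (hq : 0 < q) (s : Finset ℕ) (b : ℕ → 𝕜) {n : ℕ}
    (hn : n ∈ s) : ‖b n‖ ≤ ‖∑ n ∈ s, b n • unitVector 𝕜 q n‖ := by
  have h := lp.norm_apply_le_norm hq.ne' (∑ n ∈ s, b n • unitVector 𝕜 q n) n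
  rwa [sum_smul_unitVector_apply, if_pos hn] at h

theorem norm_sum_smul_unitVector_top_le (s : Finset ℕ) (b : ℕ → 𝕜) {M : ℝ} (hM : 0 ≤ M)
    (h : ∀ n ∈ s, ‖b n‖ ≤ M) : ‖∑ n ∈ s, b n • unitVector 𝕜 ∞ n‖ ≤ M := by
  refine lp.norm_le_of_forall_le hM fun n => ?_
  rw [sum_smul_unitVector_apply]
  split_ifs with hn
  · exact h n hn
  · simpa using hM

/-- For `q = ∞` the conventions `∞.toReal = 0` and `0⁻¹ = 0` make the right side `1`, as it should
be. Nonemptiness is essential there, since `0 ^ 0 = 1`. -/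
theorem norm_sum_unitVector (hq : 0 < q) {s : Finset ℕ} (hs : s.Nonempty) :
    ‖∑ n ∈ s, unitVector 𝕜 q n‖ = (s.card : ℝ) ^ (q.toReal)⁻¹ := by
  have h1 : ∑ n ∈ s, unitVector 𝕜 q n = ∑ n ∈ s, (1 : 𝕜) • unitVector 𝕜 q n := by simp
  rw [h1]
  by_cases hq' : q = ∞
  · subst hq'
    obtain ⟨n, hn⟩ := hs
    refine le_antisymm ?_ ?_
    · simpa using norm_sum_smul_unitVector_top_le s (fun _ => (1 : 𝕜)) zero_le_one (by simp)
    · simpa using norm_le_norm_sum_smul_unitVector hq s (fun _ => (1 : 𝕜)) hn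
  · have h := norm_sum_smul_unitVector_rpow hq hq' s (fun _ => (1 : 𝕜))
    rw [← Real.rpow_rpow_inv (lp.norm_nonneg' _) (ENNReal.toReal_pos hq.ne' hq').ne', h]
    simp

end UnitVectors

end VarLebesgue

namespace VarLebesgue

open Filter Topology

variable {𝕜 : Type*} [RCLike 𝕜] {Ω : Type*} [MeasurableSpace Ω] {μ ν : Measure Ω}
  {P : VariableExponent Ω}

/-! ### Necessity: `q` lies in the essential range. -/

section Necessity

theorem exists_nat_mul_rpow_lt {s a C δ : ℝ} (hsa : s < a) (hδ : 0 < δ) :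
    ∃ N : ℕ, 0 < N ∧ C * (N : ℝ) ^ s < δ * (N : ℝ) ^ a := by
  have h1 : Tendsto (fun N : ℕ => (N : ℝ) ^ (a - s)) atTop atTop :=
    (tendsto_rpow_atTop (sub_pos.2 hsa)).comp tendsto_natCast_atTop_atTop
  obtain ⟨N, hN, hN0⟩ := ((h1.eventually_gt_atTop (C / δ)).and (eventually_gt_atTop 0)).exists
  refine ⟨N, hN0, ?_⟩
  have hN' : (0 : ℝ) < N := by exact_mod_cast hN0
  have hs : (0 : ℝ) < (N : ℝ) ^ s := Real.rpow_pos_of_pos hN' s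
  rw [Real.rpow_sub hN', div_lt_div_iff₀ hδ hs] at hN
  linarith

theorem inv_rpow_inv_rpow {N r : ℝ} (hN : 0 < N) (hr : 0 < r) : (1 / N ^ r⁻¹) ^ r = N⁻¹ := by
  rw [one_div, Real.inv_rpow (by positivity), Real.rpow_inv_rpow hN.le hr.ne']

/-- Where the exponent is at most `p < 1 / s`, a disjoint sequence whose finite sums grow at most
like `N ^ s` is eventually small. -/
theorem finite_setOf_one_le_modular (hP : 0 < lowerExponent P μ) {x : ℕ → VarLp 𝕜 P μ}
    (hx : DisjointlySupported x) {C s p δ : ℝ} (hp : 0 < p) (hsp : s < p⁻¹) (hδ : 0 < δ)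
    (hC : ∀ S : Finset ℕ, S.Nonempty → ‖∑ n ∈ S, x n‖ ≤ C * (S.card : ℝ) ^ s)
    (hν : ν ≤ μ) (hPν : ∀ᵐ ω ∂ν, P.toFun ω ≤ ENNReal.ofReal p) :
    {n | 1 ≤ modular P ν (fun ω => ‖(x n : Ω →ₘ[μ] 𝕜) ω‖ₑ / ENNReal.ofReal δ)}.Finite := by
  by_contra hinf
  obtain ⟨N, hN0, hN⟩ := exists_nat_mul_rpow_lt (C := C) hsp hδ
  obtain ⟨S, hS, rfl⟩ := Set.Infinite.exists_subset_card_eq hinf N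
  have hN1 : (1 : ℝ) ≤ S.card := by exact_mod_cast hN0
  have hN' : (0 : ℝ) < S.card := zero_lt_one.trans_le hN1
  have hle : δ ≤ δ * (S.card : ℝ) ^ p⁻¹ :=
    le_mul_of_one_le_right hδ.le (Real.one_le_rpow hN1 (by positivity))
  have h1 := modular_lt_one_of_norm_lt hP _ ((hC S (Finset.card_pos.1 hN0)).trans_lt hN)
  refine absurd ((modular_mono_measure hν _).trans_lt h1) (not_lt.2 ?_)
  rw [hx.modular_sum_one (Measure.absolutelyContinuous_of_le hν)]
  -- Passing from `δ` to `δ N ^ (1 / p)` costs each term at most a factor `1 / N`, so `N` terms of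
  -- modular at least `1` still add up to at least `1`.
  calc (1 : ℝ≥0∞) = ∑ n ∈ S, ENNReal.ofReal ((S.card : ℝ)⁻¹) * 1 := by
        rw [Finset.sum_const, nsmul_eq_mul, mul_one, ENNReal.ofReal_inv_of_pos hN',
          ENNReal.ofReal_natCast, ENNReal.mul_inv_cancel (by exact_mod_cast hN0.ne')
            (ENNReal.natCast_ne_top _)]
    _ ≤ _ := by
      refine Finset.sum_le_sum fun n hn => ?_
      have hn1 : 1 ≤ modular P ν (fun ω => ‖(x n : Ω →ₘ[μ] 𝕜) ω‖ₑ / ENNReal.ofReal δ) := hS hn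
      refine le_trans ?_ (le_modular_div hp.le hPν hδ hle _)
      rw [div_mul_cancel_left₀ hδ.ne', ← one_div (_ ^ _), inv_rpow_inv_rpow hN' hp]
      gcongr

/-- At level `T = K (3N) ^ (1 / p)` each of the `N` terms contributes at most `1 / (3N)` on `Aᶜ`, by
scaling from `K`, and at most `1 / (3N)` on `A`, by smallness. The total is at most `2 / 3 < 1`. -/
theorem norm_sum_le_of_modular_split (hP : 0 < lowerExponent P μ) {x : ℕ → VarLp 𝕜 P μ}
    (hx : DisjointlySupported x) {A : Set Ω} (hA : MeasurableSet A) {p K : ℝ} (hp : 0 < p)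
    (hK : 0 < K)
    (hPA : ∀ᵐ ω ∂(μ.restrict Aᶜ), ENNReal.ofReal p ≤ P.toFun ω)
    (hxK : ∀ n, ‖x n‖ < K)
    (hfin : ∀ δ : ℝ, 0 < δ → {n | 1 ≤ modular P (μ.restrict A)
      (fun ω => ‖(x n : Ω →ₘ[μ] 𝕜) ω‖ₑ / ENNReal.ofReal δ)}.Finite) (N : ℕ) (hN : 0 < N) :
    ∃ S : Finset ℕ, S.card = N ∧ ‖∑ n ∈ S, x n‖ ≤ K * (3 * N : ℝ) ^ p⁻¹ := by
  obtain ⟨r, hr, hPr⟩ := exists_pos_ae_ofReal_le hP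
  have hN' : (1 : ℝ) ≤ N := by exact_mod_cast hN
  have hM : (1 : ℝ) ≤ 3 * N := by linarith
  have hM0 : (0 : ℝ) < 3 * N := by linarith
  set T := K * (3 * N : ℝ) ^ p⁻¹ with hT
  have hT0 : 0 < T := by positivity
  have hKT : K ≤ T := le_mul_of_one_le_right hK.le (Real.one_le_rpow hM (by positivity))
  -- On `A` only `P ≥ r` is known; this `δ` makes the step from `δ` to `T` gain exactly the factor
  -- `1 / (3N)`.
  set δ := T / (3 * N : ℝ) ^ r⁻¹ with hδ
  have hδ0 : 0 < δ := by positivity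
  have hδT : δ ≤ T := div_le_self hT0.le (Real.one_le_rpow hM (by positivity))
  obtain ⟨S, hS, hcard⟩ := Set.Infinite.exists_subset_card_eq (hfin δ hδ0).infinite_compl N
  refine ⟨S, hcard, norm_le_of_modular_lt_one _ hT0 ?_⟩
  rw [hx.modular_sum_one Measure.AbsolutelyContinuous.rfl]
  have hterm : ∀ n ∈ S, modular P μ (fun ω => ‖(x n : Ω →ₘ[μ] 𝕜) ω‖ₑ / ENNReal.ofReal T) ≤
      ENNReal.ofReal (2 * (3 * N : ℝ)⁻¹) := by
    intro n hn
    have hsplit : modular P μ (fun ω => ‖(x n : Ω →ₘ[μ] 𝕜) ω‖ₑ / ENNReal.ofReal T) =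
        modular P (μ.restrict A) (fun ω => ‖(x n : Ω →ₘ[μ] 𝕜) ω‖ₑ / ENNReal.ofReal T) +
        modular P (μ.restrict Aᶜ) (fun ω => ‖(x n : Ω →ₘ[μ] 𝕜) ω‖ₑ / ENNReal.ofReal T) :=
      (lintegral_add_compl _ hA).symm
    rw [hsplit, two_mul, ENNReal.ofReal_add (by positivity) (by positivity)]
    refine add_le_add ?_ ?_
    · refine (modular_div_le hr.le (ae_restrict_of_ae hPr) hδ0 hδT _).trans ?_
      have e : δ / T = 1 / (3 * N : ℝ) ^ r⁻¹ := by rw [hδ]; field_simp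
      rw [e, inv_rpow_inv_rpow hM0 hr]
      exact mul_le_of_le_one_right zero_le (lt_of_not_ge (Set.notMem_ofPred_iff.1 (hS hn))).le
    · refine (modular_div_le hp.le hPA hK hKT _).trans ?_
      have e : K / T = 1 / (3 * N : ℝ) ^ p⁻¹ := by rw [hT]; field_simp
      rw [e, inv_rpow_inv_rpow hM0 hp]
      exact mul_le_of_le_one_right zero_le ((modular_mono_measure Measure.restrict_le_self _).trans
        (modular_lt_one_of_norm_lt hP _ (hxK n)).le)
  refine (Finset.sum_le_card_nsmul S _ _ hterm).trans_lt ?_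
  rw [hcard, ← ENNReal.ofReal_nsmul, nsmul_eq_mul, ENNReal.ofReal_lt_one]
  have : (N : ℝ) * (2 * (3 * N : ℝ)⁻¹) = 2 / 3 := by field_simp
  rw [this]; norm_num

/-- The inner measurable set `V` spares a measurability proof for neighbourhoods `U` given only by
an eventual property. -/
theorem mem_essentialRange_iff {q : ℝ≥0∞} :
    q ∈ essentialRange P μ ↔ ∀ U ∈ 𝓝 q, ∃ V ⊆ U, MeasurableSet V ∧ 0 < μ (P.toFun ⁻¹' V) := by
  rw [essentialRange, Measure.mem_support_iff_forall]
  constructor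
  · intro h U hU
    obtain ⟨V, hVU, hV, hqV⟩ := mem_nhds_iff.1 hU
    refine ⟨V, hVU, hV.measurableSet, ?_⟩
    rw [← Measure.map_apply P.measurable hV.measurableSet]
    exact h V (hV.mem_nhds hqV)
  · intro h U hU
    obtain ⟨V, hVU, hV, h0⟩ := h U hU
    rw [← Measure.map_apply P.measurable hV] at h0
    exact h0.trans_le (measure_mono hVU)

theorem ae_notMem_of_notMem_essentialRange {q : ℝ≥0∞} (h : q ∉ essentialRange P μ) :
    ∃ U ∈ 𝓝 q, ∀ᵐ ω ∂μ, P.toFun ω ∉ U := by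
  rw [mem_essentialRange_iff] at h
  push Not at h
  obtain ⟨U, hU, h⟩ := h
  obtain ⟨V, hVU, hV, hqV⟩ := mem_nhds_iff.1 hU
  refine ⟨V, hV.mem_nhds hqV, ?_⟩
  exact measure_eq_zero_iff_ae_notMem.1 (le_antisymm (h V hVU hV.measurableSet) zero_le)

theorem mem_essentialRange_of_equivalentSequences (hP : 0 < lowerExponent P μ) {q : ℝ≥0∞}
    (hq : 0 < q) {x : ℕ → VarLp 𝕜 P μ} (hx : DisjointlySupported x)
    (hxq : EquivalentSequences 𝕜 x (unitVector 𝕜 q)) : q ∈ essentialRange P μ := by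
  by_contra hqR
  obtain ⟨U, hU, hPU⟩ := ae_notMem_of_notMem_essentialRange hqR
  obtain ⟨c, C, hc, hC, hbd⟩ := hxq.exists_finset_sum_bounds
  have hlow : ∀ S : Finset ℕ, S.Nonempty →
      c * (S.card : ℝ) ^ (q.toReal)⁻¹ ≤ ‖∑ n ∈ S, x n‖ := fun S hS => by
    rw [← norm_sum_unitVector (𝕜 := 𝕜) hq hS]; exact (hbd S).1
  have hup : ∀ S : Finset ℕ, S.Nonempty →
      ‖∑ n ∈ S, x n‖ ≤ C * (S.card : ℝ) ^ (q.toReal)⁻¹ := fun S hS => by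
    rw [← norm_sum_unitVector (𝕜 := 𝕜) hq hS]; exact (hbd S).2
  -- A one-sided neighbourhood is used because `q = ∞` has nothing above it; the upper gap is
  -- extracted later, for finite `q` only.
  obtain ⟨l, hlq, hlU⟩ := exists_Ioc_subset_of_mem_nhds hU ⟨0, hq⟩
  obtain ⟨p, hp, hp'⟩ := ENNReal.lt_iff_exists_nnreal_btwn.1 hlq
  have hp0 : (0 : ℝ) < p := by exact_mod_cast zero_le.trans_lt hp
  have hsp : (q.toReal)⁻¹ < (p : ℝ)⁻¹ := by
    by_cases hq' : q = ∞
    · simpa [hq'] using hp0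
    · have : (p : ℝ) < q.toReal := by
        simpa using (ENNReal.toReal_lt_toReal ENNReal.coe_ne_top hq').2 hp'
      gcongr
  have hgap : ∀ ω, P.toFun ω ∉ U → P.toFun ω ≤ q → P.toFun ω ≤ ENNReal.ofReal p := by
    intro ω h1 h2
    by_contra! h3
    rw [ENNReal.ofReal_coe_nnreal] at h3
    exact h1 (hlU ⟨hp.trans h3, h2⟩)
  have hone : ∀ n, c ≤ ‖x n‖ ∧ ‖x n‖ ≤ C := fun n => by
    simpa using And.intro (hlow {n} (by simp)) (hup {n} (by simp))
  by_cases hq' : q = ∞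
  · have hfin := finite_setOf_one_le_modular hP hx (ν := μ) hp0 hsp (half_pos hc) hup le_rfl
      (hPU.mono fun ω hω => hgap ω hω (hq' ▸ le_top))
    obtain ⟨n, hn⟩ := hfin.infinite_compl.nonempty
    have := norm_le_of_modular_lt_one _ (half_pos hc) (not_le.1 hn)
    linarith [(hone n).1]
  · obtain ⟨u, hqu, huU⟩ := exists_Ico_subset_of_mem_nhds hU ⟨∞, lt_top_iff_ne_top.2 hq'⟩
    obtain ⟨p₂, hp₂, hp₂'⟩ := ENNReal.lt_iff_exists_nnreal_btwn.1 hqu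
    have hqp : q.toReal < p₂ := by
      simpa using (ENNReal.toReal_lt_toReal hq' ENNReal.coe_ne_top).2 hp₂
    have hq0 : 0 < q.toReal := ENNReal.toReal_pos hq.ne' hq'
    have hA : MeasurableSet {ω | P.toFun ω ≤ q} := P.measurable measurableSet_Iic
    have hfin := fun δ hδ => finite_setOf_one_le_modular hP hx (δ := δ) hp0 hsp hδ hup
      (Measure.restrict_le_self (μ := μ) (s := {ω | P.toFun ω ≤ q})) (by
        rw [ae_restrict_iff' hA]
        exact hPU.mono fun ω h1 h2 => hgap ω h1 h2)
    have hPA : ∀ᵐ ω ∂(μ.restrict {ω | P.toFun ω ≤ q}ᶜ), ENNReal.ofReal p₂ ≤ P.toFun ω := by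
      rw [ae_restrict_iff' hA.compl]
      refine hPU.mono fun ω h1 h2 => ?_
      by_contra! h3
      rw [ENNReal.ofReal_coe_nnreal] at h3
      exact h1 (huU ⟨(lt_of_not_ge (Set.notMem_ofPred_iff.1 h2)).le, h3.trans hp₂'⟩)
    have hlt : (p₂ : ℝ)⁻¹ < (q.toReal)⁻¹ := by gcongr
    -- `C + 1` gives the strict bound `‖x n‖ < K`, and the power of `3` comes from `(3N) ^ (1 /
    -- p₂)`.
    obtain ⟨N, hN0, hN⟩ := exists_nat_mul_rpow_lt (C := (C + 1) * 3 ^ (p₂ : ℝ)⁻¹) hlt hc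
    obtain ⟨S, hS, hSn⟩ := norm_sum_le_of_modular_split hP hx hA (hq0.trans hqp)
      (by linarith : 0 < C + 1) hPA (fun n => by linarith [(hone n).2]) hfin N hN0
    have h := (hlow S (Finset.card_pos.1 (hS ▸ hN0))).trans hSn
    rw [hS, Real.mul_rpow (by norm_num) (Nat.cast_nonneg N)] at h
    linarith

end Necessity

end VarLebesgue

namespace VarLebesgue

open Filter Topology

/-! ### Continuity of the potential in the exponent. -/

section PotentialContinuity

theorem potential_ofReal {p : ℝ≥0∞} (hp : p ≠ ∞) {y : ℝ} (hy : 0 ≤ y) :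
    potential p (ENNReal.ofReal y) = ENNReal.ofReal (y ^ p.toReal) := by
  rw [potential, if_neg hp, ENNReal.ofReal_rpow_of_nonneg hy ENNReal.toReal_nonneg]

theorem potential_top_of_le_one {θ : ℝ≥0∞} (h : θ ≤ 1) : potential ∞ θ = 0 := by
  simp [potential, h]

theorem one_le_potential (p : ℝ≥0∞) {θ : ℝ≥0∞} (h : 1 < θ) : 1 ≤ potential p θ := by
  unfold potential
  split_ifs with h1 h2
  · exact absurd h2 (not_le.2 h)
  · exact le_top
  · simpa using ENNReal.rpow_le_rpow h.le (ENNReal.toReal_nonneg (a := p))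

/-- The potential depends continuously on the exponent, uniformly on `[0, 1 / 2]`. -/
theorem eventually_potential_close {q : ℝ≥0∞} (hq : 0 < q) {d : ℝ} (hd : 0 < d) :
    ∀ᶠ p in 𝓝 q, ∀ y : ℝ, 0 ≤ y → y ≤ 1 / 2 →
      potential p (ENNReal.ofReal y) ≤ potential q (ENNReal.ofReal y) + ENNReal.ofReal d ∧
      potential q (ENNReal.ofReal y) ≤ potential p (ENNReal.ofReal y) + ENNReal.ofReal d := by
  by_cases hq' : q = ∞
  · subst hq'
    -- At `q = ∞` the powers `y ^ p` tend to `0` uniformly only away from `y = 1`, whence the bound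
    -- `1 / 2` on `y`.
    obtain ⟨n, hn⟩ := exists_pow_lt_of_lt_one hd (by norm_num : (1 / 2 : ℝ) < 1)
    filter_upwards [lt_mem_nhds (ENNReal.natCast_lt_top n)] with p hp y hy0 hy
    have h1 : ENNReal.ofReal y ≤ 1 := by
      rw [ENNReal.ofReal_le_one]; linarith
    rw [potential_top_of_le_one h1]
    refine ⟨?_, zero_le⟩
    by_cases hp' : p = ∞
    · simp [hp', potential_top_of_le_one h1]
    · rw [potential_ofReal hp' hy0, zero_add]
      refine ENNReal.ofReal_le_ofReal (le_trans ?_ hn.le)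
      have hnp : (n : ℝ) ≤ p.toReal := by
        simpa using ENNReal.toReal_mono hp' hp.le
      calc y ^ p.toReal ≤ (1 / 2 : ℝ) ^ p.toReal :=
            Real.rpow_le_rpow hy0 hy ENNReal.toReal_nonneg
        _ ≤ (1 / 2 : ℝ) ^ (n : ℝ) :=
            Real.rpow_le_rpow_of_exponent_ge (by norm_num) (by norm_num) hnp
        _ = _ := Real.rpow_natCast _ _
  · have hq0 : 0 < q.toReal := ENNReal.toReal_pos hq.ne' hq'
    -- Joint continuity of `y ^ p` holds even at `y = 0` because `q > 0`; compactness of `[0, 1 /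
    -- 2]` then gives uniformity.
    have hcont : ∀ y ∈ Set.Icc (0 : ℝ) (1 / 2), ∀ᶠ z : ℝ × ℝ in 𝓝 (q.toReal, y),
        |z.2 ^ z.1 - z.2 ^ q.toReal| < d := by
      intro y _
      have h : ContinuousAt (fun z : ℝ × ℝ => |z.2 ^ z.1 - z.2 ^ q.toReal|) (q.toReal, y) :=
        ((continuousAt_snd.rpow continuousAt_fst (Or.inr hq0)).sub
          (continuousAt_snd.rpow continuousAt_const (Or.inr hq0))).abs
      exact h.eventually_lt continuousAt_const (by simpa using hd)
    have hev := isCompact_Icc.eventually_forall_of_forall_eventually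
      (P := fun (p : ℝ) (y : ℝ) => |y ^ p - y ^ q.toReal| < d) hcont
    filter_upwards [(ENNReal.tendsto_toReal hq').eventually hev,
      gt_mem_nhds (lt_top_iff_ne_top.2 hq')] with p hp hp' y hy0 hy
    have h := abs_sub_lt_iff.1 (hp y ⟨hy0, hy⟩)
    rw [potential_ofReal hp'.ne hy0, potential_ofReal hq' hy0,
      ← ENNReal.ofReal_add (by positivity) hd.le, ← ENNReal.ofReal_add (by positivity) hd.le]
    constructor <;> apply ENNReal.ofReal_le_ofReal <;> linarith

end PotentialContinuity

variable {𝕜 : Type*} [RCLike 𝕜] {Ω : Type*} [MeasurableSpace Ω] {μ ν : Measure Ω}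
  {P : VariableExponent Ω}

/-! ### Small and disjoint subsets in nonatomic measures. -/

section Nonatomic

theorem IsNonatomic.exists_subset_le_half (hμ : IsNonatomic μ) {A : Set Ω} (hA : MeasurableSet A)
    (h0 : 0 < μ A) (hfin : μ A ≠ ∞) :
    ∃ B ⊆ A, MeasurableSet B ∧ 0 < μ B ∧ μ B ≤ μ A / 2 := by
  have h := hμ A
  simp only [IsMeasureAtom, hA, h0, true_and] at h
  push Not at h
  obtain ⟨B, hBA, hB, hB0, hAB0⟩ := h
  have hsum : μ B + μ (A \ B) = μ A := by
    rw [measure_sdiff hBA hB.nullMeasurableSet (ne_top_of_le_ne_top hfin (measure_mono hBA)),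
      add_tsub_cancel_of_le (measure_mono hBA)]
  by_cases hle : μ B ≤ μ A / 2
  · exact ⟨B, hBA, hB, pos_iff_ne_zero.2 hB0, hle⟩
  · refine ⟨A \ B, Set.sdiff_subset, hA.diff hB, pos_iff_ne_zero.2 hAB0, ?_⟩
    by_contra! h
    have := ENNReal.add_lt_add (not_le.1 hle) h
    rw [hsum, ENNReal.add_halves] at this
    exact lt_irrefl _ this

theorem IsNonatomic.exists_subset_lt [SigmaFinite μ] (hμ : IsNonatomic μ) {A : Set Ω}
    (hA : MeasurableSet A) (h0 : 0 < μ A) {ε : ℝ≥0∞} (hε : 0 < ε) :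
    ∃ B ⊆ A, MeasurableSet B ∧ 0 < μ B ∧ μ B < ε := by
  obtain ⟨B, hB, hBA, hB0, hBfin⟩ := Measure.exists_subset_measure_lt_top hA h0
  have key : ∀ n : ℕ, ∃ D ⊆ B, MeasurableSet D ∧ 0 < μ D ∧ μ D ≤ μ B * (2⁻¹) ^ n := by
    intro n
    induction n with
    | zero => exact ⟨B, subset_rfl, hB, hB0, by simp⟩
    | succ n ih =>
      obtain ⟨D, hDB, hD, hD0, hDn⟩ := ih
      obtain ⟨D', hD', hDm, hD0', hle⟩ := hμ.exists_subset_le_half hD hD0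
        ((measure_mono hDB).trans_lt hBfin).ne
      refine ⟨D', hD'.trans hDB, hDm, hD0', hle.trans ?_⟩
      rw [pow_succ, ← mul_assoc, div_eq_mul_inv]
      gcongr
  have hlim : Tendsto (fun n : ℕ => μ B * (2⁻¹ : ℝ≥0∞) ^ n) atTop (𝓝 (μ B * 0)) :=
    ENNReal.Tendsto.const_mul (ENNReal.tendsto_pow_atTop_nhds_zero_of_lt_one (by simp))
      (Or.inr hBfin.ne)
  rw [mul_zero] at hlim
  obtain ⟨n, hn⟩ := (hlim.eventually (gt_mem_nhds hε)).exists
  obtain ⟨D, hDB, hD, hD0, hDn⟩ := key n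
  exact ⟨D, hDB.trans hBA, hD, hD0, hDn.trans_lt hn⟩

/-- Sets of positive measure in a nonatomic measure space have pairwise disjoint subsets of
positive finite measure. -/
theorem IsNonatomic.exists_pairwise_disjoint [SigmaFinite μ] (hμ : IsNonatomic μ) {G : ℕ → Set Ω}
    (hG : ∀ n, MeasurableSet (G n)) (hG0 : ∀ n, 0 < μ (G n)) :
    ∃ E : ℕ → Set Ω, (∀ n, E n ⊆ G n) ∧ (∀ n, MeasurableSet (E n)) ∧ (∀ n, 0 < μ (E n)) ∧
      (∀ n, μ (E n) ≠ ∞) ∧ Pairwise (Disjoint on E) := by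
  obtain ⟨B₀, hB₀G, hB₀, hB₀0, hB₀1⟩ := hμ.exists_subset_lt (hG 0) (hG0 0) one_pos
  let T := {B : Set Ω // MeasurableSet B ∧ 0 < μ B ∧ μ B ≠ ∞}
  -- With ratio `1 / 4`, all later sets together have at most a third of the measure of the current
  -- one. Removing them gives disjointness and leaves positive measure.
  have step : ∀ (n : ℕ) (B : T), ∃ B' : T, B'.1 ⊆ G (n + 1) ∧ μ B'.1 ≤ 4⁻¹ * μ B.1 := by
    rintro n ⟨B, hB, hB0, hBfin⟩
    have hpos : 0 < 4⁻¹ * μ B := ENNReal.mul_pos (by simp) hB0.ne'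
    obtain ⟨D, hDG, hD, hD0, hDB⟩ := hμ.exists_subset_lt (hG (n + 1)) (hG0 (n + 1)) hpos
    exact ⟨⟨D, hD, hD0, hDB.ne_top⟩, hDG, hDB.le⟩
  choose g hgG hg using step
  let F : ℕ → T := fun n =>
    Nat.rec ⟨B₀, hB₀, hB₀0, (hB₀1.trans ENNReal.one_lt_top).ne⟩ (fun n B => g n B) n
  have hFG : ∀ n, (F n).1 ⊆ G n := by
    rintro (_ | n)
    · exact hB₀G
    · exact hgG n (F n)
  have hF : ∀ n k, μ (F (n + k)).1 ≤ μ (F n).1 * 4⁻¹ ^ k := by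
    intro n k
    induction k with
    | zero => simp
    | succ k ih =>
      refine (hg (n + k) (F (n + k))).trans ?_
      rw [pow_succ, ← mul_assoc, mul_comm]
      gcongr
  refine ⟨fun n => (F n).1 \ ⋃ k, (F (n + (k + 1))).1, fun n => Set.sdiff_subset.trans (hFG n),
    fun n => (F n).2.1.diff (MeasurableSet.iUnion fun k => (F (n + (k + 1))).2.1), fun n => ?_,
    fun n => ne_top_of_le_ne_top (F n).2.2.2 (measure_mono Set.sdiff_subset), ?_⟩
  · refine lt_of_lt_of_le (tsub_pos_of_lt ?_) le_measure_sdiff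
    calc μ (⋃ k, (F (n + (k + 1))).1) ≤ ∑' k, μ (F (n + (k + 1))).1 := measure_iUnion_le _
      _ ≤ ∑' k : ℕ, μ (F n).1 * 4⁻¹ ^ (k + 1) := ENNReal.tsum_le_tsum fun k => hF n (k + 1)
      _ = μ (F n).1 * (4⁻¹ * (1 - 4⁻¹)⁻¹) := by
        rw [ENNReal.tsum_mul_left, ENNReal.tsum_geometric_add_one]
      _ < μ (F n).1 * 1 := by
        refine (ENNReal.mul_lt_mul_iff_right (F n).2.2.1.ne' (F n).2.2.2).2 ?_
        have h4 : (4⁻¹ : ℝ≥0∞) = ENNReal.ofReal (1 / 4) := by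
          rw [one_div, ENNReal.ofReal_inv_of_pos (by norm_num)]; simp
        rw [h4, ← ENNReal.ofReal_one, ← ENNReal.ofReal_sub _ (by norm_num),
          ← ENNReal.ofReal_inv_of_pos (by norm_num), ← ENNReal.ofReal_mul (by norm_num)]
        rw [ENNReal.ofReal_lt_ofReal_iff (by norm_num)]
        norm_num
      _ = _ := mul_one _
  · refine (pairwise_disjoint_on _).2 fun m n hmn => ?_
    obtain ⟨k, rfl⟩ := Nat.exists_eq_add_of_lt hmn
    refine Set.disjoint_left.2 fun ω h1 h2 => h1.2 (Set.mem_iUnion.2 ⟨k, ?_⟩)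
    exact h2.1

end Nonatomic

/-! ### The normalized blocks. -/

section Blocks

/-- The function `μ(E) ^ (-1 / P)` on `E`, zero elsewhere. -/
noncomputable def blockFun (𝕜 : Type*) [RCLike 𝕜] (P : VariableExponent Ω) (μ : Measure Ω) (E : Set Ω) :
    Ω → 𝕜 :=
  E.indicator fun ω => (((μ E).toReal ^ (-((P.toFun ω)⁻¹).toReal) : ℝ) : 𝕜)

theorem measurable_blockFun {E : Set Ω} (hE : MeasurableSet E) :
    Measurable (blockFun 𝕜 P μ E) :=
  (RCLike.measurable_ofReal.comp
    (measurable_const.pow P.measurable.inv.ennreal_toReal.neg)).indicator hE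

/-- The case `p = ∞` fits: the factor is `m ^ 0 = 1`, and the values `0` and `∞` of `Φ_∞` are
unchanged by `m⁻¹`. -/
theorem potential_mul_rpow_neg_inv {p θ m : ℝ≥0∞} (hp : 0 < p) (hm : 0 < m) (hm' : m ≠ ∞) :
    potential p (θ * ENNReal.ofReal (m.toReal ^ (-(p⁻¹).toReal))) = potential p θ * m⁻¹ := by
  unfold potential
  split_ifs with h h1 h2 h2
  · simp
  · subst h; simp at h1; exact absurd h1 h2
  · subst h; simp at h1; exact absurd h2 (not_le.2 h1)
  · rw [ENNReal.top_mul (ENNReal.inv_ne_zero.2 hm')]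
  · have hm0 := ENNReal.toReal_pos hm.ne' hm'
    have hp0 := ENNReal.toReal_pos hp.ne' h
    rw [ENNReal.mul_rpow_of_nonneg _ _ hp0.le,
      ENNReal.ofReal_rpow_of_nonneg (by positivity) hp0.le, ENNReal.toReal_inv,
      ← Real.rpow_mul hm0.le, neg_mul, inv_mul_cancel₀ hp0.ne', Real.rpow_neg_one,
      ENNReal.ofReal_inv_of_pos hm0, ENNReal.ofReal_toReal hm']

/-- The normalization turns the modular into the average of `Φ_P(θ)` over `E`, so bounds on `Φ_P`
over `E` pass to it without constants. -/
theorem modular_blockFun {E : Set Ω} (hE : MeasurableSet E) (h0 : 0 < μ E) (hfin : μ E ≠ ∞)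
    (θ : ℝ≥0∞) :
    modular P μ (fun ω => θ * ‖blockFun 𝕜 P μ E ω‖ₑ) =
      (∫⁻ ω in E, potential (P.toFun ω) θ ∂μ) * (μ E)⁻¹ := by
  rw [← lintegral_mul_const' _ _ (ENNReal.inv_ne_top.2 h0.ne'), ← lintegral_indicator hE]
  refine lintegral_congr fun ω => ?_
  beta_reduce
  by_cases hω : ω ∈ E
  · rw [Set.indicator_of_mem hω, blockFun, Set.indicator_of_mem hω,
      ← potential_mul_rpow_neg_inv (P.pos ω) h0 hfin, ← ofReal_norm, RCLike.norm_ofReal,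
      abs_of_nonneg (by positivity)]
  · rw [Set.indicator_of_notMem hω, blockFun, Set.indicator_of_notMem hω]
    simp [potential_zero (P.pos ω)]

theorem setLIntegral_mul_inv_le {E : Set Ω} (hE : MeasurableSet E) (h0 : 0 < μ E) (hfin : μ E ≠ ∞)
    {g : Ω → ℝ≥0∞} {c : ℝ≥0∞} (hg : ∀ ω ∈ E, g ω ≤ c) : (∫⁻ ω in E, g ω ∂μ) * (μ E)⁻¹ ≤ c := by
  calc _ ≤ (∫⁻ _ in E, c ∂μ) * (μ E)⁻¹ := by gcongr ?_ * _; exact setLIntegral_mono' hE hg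
    _ = c := by rw [setLIntegral_const, mul_assoc, ENNReal.mul_inv_cancel h0.ne' hfin, mul_one]

theorem le_setLIntegral_mul_inv {E : Set Ω} (hE : MeasurableSet E) (h0 : 0 < μ E) (hfin : μ E ≠ ∞)
    {g : Ω → ℝ≥0∞} {c : ℝ≥0∞} (hg : ∀ ω ∈ E, c ≤ g ω) : c ≤ (∫⁻ ω in E, g ω ∂μ) * (μ E)⁻¹ := by
  calc c = (∫⁻ _ in E, c ∂μ) * (μ E)⁻¹ := by
        rw [setLIntegral_const, mul_assoc, ENNReal.mul_inv_cancel h0.ne' hfin, mul_one]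
    _ ≤ _ := by gcongr ?_ * _; exact setLIntegral_mono' hE hg

/-- The class of `blockFun` as an element of `L_P(μ)`. -/
noncomputable def block (𝕜 : Type*) [RCLike 𝕜] (P : VariableExponent Ω) (μ : Measure Ω) {E : Set Ω}
    (hE : MeasurableSet E) (h0 : 0 < μ E) (hfin : μ E ≠ ∞) : VarLp 𝕜 P μ :=
  ⟨AEEqFun.mk (blockFun 𝕜 P μ E) (measurable_blockFun hE).aestronglyMeasurable, 1, one_pos, by
    refine lt_of_le_of_lt ?_ ENNReal.one_lt_top
    refine (modular_mono P μ (g := fun ω => 1 * ‖blockFun 𝕜 P μ E ω‖ₑ) ?_).trans ?_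
    · filter_upwards [AEEqFun.coeFn_mk (blockFun 𝕜 P μ E)
        (measurable_blockFun (𝕜 := 𝕜) (P := P) (μ := μ) hE).aestronglyMeasurable] with ω hω
      rw [hω, ENNReal.coe_one]
    · rw [modular_blockFun hE h0 hfin]
      refine setLIntegral_mul_inv_le hE h0 hfin fun ω _ => ?_
      unfold potential
      split_ifs <;> simp_all⟩

theorem coeFn_block {E : Set Ω} (hE : MeasurableSet E) (h0 : 0 < μ E) (hfin : μ E ≠ ∞) :
    (block 𝕜 P μ hE h0 hfin : Ω →ₘ[μ] 𝕜) =ᵐ[μ] blockFun 𝕜 P μ E :=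
  AEEqFun.coeFn_mk _ _

theorem modular_smul_block {E : Set Ω} (hE : MeasurableSet E) (h0 : 0 < μ E) (hfin : μ E ≠ ∞)
    (b : 𝕜) {t : ℝ} (ht : 0 < t) :
    modular P μ (fun ω => ‖b • (block 𝕜 P μ hE h0 hfin : Ω →ₘ[μ] 𝕜) ω‖ₑ / ENNReal.ofReal t) =
      (∫⁻ ω in E, potential (P.toFun ω) (ENNReal.ofReal (‖b‖ / t)) ∂μ) * (μ E)⁻¹ := by
  rw [← modular_blockFun (𝕜 := 𝕜) hE h0 hfin]
  refine lintegral_congr_ae ?_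
  filter_upwards [coeFn_block (𝕜 := 𝕜) (P := P) hE h0 hfin] with ω hω
  rw [hω, enorm_smul, ENNReal.ofReal_div_of_pos ht, ofReal_norm, ENNReal.mul_div_right_comm]

theorem disjointlySupported_block {E : ℕ → Set Ω} (hE : ∀ n, MeasurableSet (E n))
    (h0 : ∀ n, 0 < μ (E n)) (hfin : ∀ n, μ (E n) ≠ ∞) (hdisj : Pairwise (Disjoint on E)) :
    DisjointlySupported fun n => block 𝕜 P μ (hE n) (h0 n) (hfin n) := by
  intro n m hnm
  refine measure_eq_zero_iff_ae_notMem.2 ?_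
  filter_upwards [coeFn_block (𝕜 := 𝕜) (P := P) (hE n) (h0 n) (hfin n),
    coeFn_block (𝕜 := 𝕜) (P := P) (hE m) (h0 m) (hfin m)] with ω h1 h2 h3
  have h4 := h3.1
  have h5 := h3.2
  rw [mem_support, h1, blockFun] at h4
  rw [mem_support, h2, blockFun] at h5
  exact Set.disjoint_left.1 (hdisj hnm) (Set.mem_of_indicator_ne_zero h4)
    (Set.mem_of_indicator_ne_zero h5)

end Blocks

/-! ### Sufficiency: blocks equivalent to the unit vectors. -/

section Sufficiency

theorem VarLp.norm_zero : ‖(0 : VarLp 𝕜 P μ)‖ = 0 := by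
  refine le_antisymm (le_of_forall_pos_le_add fun t ht => ?_) ENNReal.toReal_nonneg
  rw [zero_add]
  refine norm_le_of_modular_lt_one _ ht (lt_of_le_of_lt (modular_mono P μ (g := 0) ?_) ?_)
  · filter_upwards [AEEqFun.coeFn_zero (μ := μ) (β := 𝕜) (α := Ω)] with ω hω
    simp [hω]
  · simp [modular, potential_zero (P.pos _)]

theorem sum_potential_div {q : ℝ≥0∞} (hq : 0 < q) (hq' : q ≠ ∞) (s : Finset ℕ) (b : ℕ → 𝕜) {t : ℝ}
    (ht : 0 < t) :
    ∑ n ∈ s, potential q (ENNReal.ofReal (‖b n‖ / t)) =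
      ENNReal.ofReal ((‖∑ n ∈ s, b n • unitVector 𝕜 q n‖ / t) ^ q.toReal) := by
  rw [Real.div_rpow (lp.norm_nonneg' _) ht.le, norm_sum_smul_unitVector_rpow hq hq',
    Finset.sum_div, ENNReal.ofReal_sum_of_nonneg (fun n _ => by positivity)]
  refine Finset.sum_congr rfl fun n _ => ?_
  rw [potential_ofReal hq' (by positivity), Real.div_rpow (norm_nonneg _) ht.le]

theorem sum_ofReal_geometric_le (s : Finset ℕ) :
    ∑ n ∈ s, ENNReal.ofReal (1 / 8 * (1 / 2) ^ n) ≤ ENNReal.ofReal (1 / 4) := by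
  rw [← ENNReal.ofReal_sum_of_nonneg (fun n _ => by positivity), ← Finset.mul_sum]
  refine ENNReal.ofReal_le_ofReal ?_
  have h := summable_geometric_two.sum_le_tsum s (fun n _ => by positivity)
  rw [tsum_geometric_two] at h
  linarith

variable {q : ℝ≥0∞} {x : ℕ → VarLp 𝕜 P μ} {w : ℕ → ℝ → ℝ≥0∞}

/-- Here `w n y` stands for the average of `Φ_P(y)` over the `n`th block. At level `K A` the `ℓ_q`
modular is at most `1 / 2` and the errors sum to at most `1 / 4`. -/
theorem norm_sum_le_of_modular_close (hq : 0 < q) {K : ℝ} (hK4 : 4 ≤ K)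
    (hK : q ≠ ∞ → 2 ≤ K ^ q.toReal) (s : Finset ℕ) (b : ℕ → 𝕜)
    (hmod : ∀ t : ℝ, 0 < t →
      modular P μ (fun ω => ‖((∑ n ∈ s, b n • x n : VarLp 𝕜 P μ) : Ω →ₘ[μ] 𝕜) ω‖ₑ /
        ENNReal.ofReal t) = ∑ n ∈ s, w n (‖b n‖ / t))
    (hw : ∀ n y, 0 ≤ y → y ≤ 1 / 2 →
      w n y ≤ potential q (ENNReal.ofReal y) + ENNReal.ofReal (1 / 8 * (1 / 2) ^ n))
    (hA : 0 < ‖∑ n ∈ s, b n • unitVector 𝕜 q n‖) :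
    ‖∑ n ∈ s, b n • x n‖ ≤ K * ‖∑ n ∈ s, b n • unitVector 𝕜 q n‖ := by
  set A := ‖∑ n ∈ s, b n • unitVector 𝕜 q n‖ with hAdef
  have hK0 : 0 < K := by linarith
  have hKA : 0 < K * A := by positivity
  have hbn : ∀ n ∈ s, ‖b n‖ / (K * A) ≤ 1 / 2 := fun n hn => by
    have := norm_le_norm_sum_smul_unitVector hq s b hn
    rw [div_le_div_iff₀ hKA two_pos]
    nlinarith
  refine norm_le_of_modular_lt_one _ hKA ?_
  rw [hmod _ hKA]
  have hsum : ∑ n ∈ s, potential q (ENNReal.ofReal (‖b n‖ / (K * A))) ≤ ENNReal.ofReal (1 / 2) := by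
    by_cases hq' : q = ∞
    · subst hq'
      rw [Finset.sum_eq_zero]
      · exact zero_le
      · intro n hn
        refine potential_top_of_le_one (ENNReal.ofReal_le_one.2 ?_)
        linarith [hbn n hn]
    · rw [sum_potential_div hq hq' s b hKA, ← hAdef]
      refine ENNReal.ofReal_le_ofReal ?_
      rw [div_mul_cancel_right₀ hA.ne', Real.inv_rpow hK0.le, one_div]
      exact inv_anti₀ two_pos (hK hq')
  calc ∑ n ∈ s, w n (‖b n‖ / (K * A))
      ≤ ∑ n ∈ s, (potential q (ENNReal.ofReal (‖b n‖ / (K * A))) +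
          ENNReal.ofReal (1 / 8 * (1 / 2) ^ n)) :=
        Finset.sum_le_sum fun n hn => hw n _ (by positivity) (hbn n hn)
    _ ≤ ENNReal.ofReal (1 / 2) + ENNReal.ofReal (1 / 4) := by
        rw [Finset.sum_add_distrib]
        exact add_le_add hsum (sum_ofReal_geometric_le s)
    _ < 1 := by
        rw [← ENNReal.ofReal_add (by norm_num) (by norm_num), ENNReal.ofReal_lt_one]
        norm_num

theorem le_norm_sum_of_modular_close (hP : 0 < lowerExponent P μ) (hq : 0 < q) {K : ℝ}
    (hK4 : 4 ≤ K) (hK : q ≠ ∞ → 2 ≤ (K / 2) ^ q.toReal) (s : Finset ℕ) (b : ℕ → 𝕜)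
    (hmod : ∀ t : ℝ, 0 < t →
      modular P μ (fun ω => ‖((∑ n ∈ s, b n • x n : VarLp 𝕜 P μ) : Ω →ₘ[μ] 𝕜) ω‖ₑ /
        ENNReal.ofReal t) = ∑ n ∈ s, w n (‖b n‖ / t))
    (hw : ∀ n y, 0 ≤ y → y ≤ 1 / 2 →
      potential q (ENNReal.ofReal y) ≤ w n y + ENNReal.ofReal (1 / 8 * (1 / 2) ^ n))
    (hw1 : ∀ n y, 1 < y → 1 ≤ w n y)
    (hA : 0 < ‖∑ n ∈ s, b n • unitVector 𝕜 q n‖) :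
    K⁻¹ * ‖∑ n ∈ s, b n • unitVector 𝕜 q n‖ ≤ ‖∑ n ∈ s, b n • x n‖ := by
  set A := ‖∑ n ∈ s, b n • unitVector 𝕜 q n‖ with hAdef
  have hK0 : 0 < K := by linarith
  by_contra! hlt
  set t := K⁻¹ * A with htdef
  have ht : 0 < t := by positivity
  -- A coefficient above `t` alone would make the modular at least `1`. Hence at level `2t` all
  -- arguments lie in `[0, 1 / 2]`, where the potentials are close.
  have hbt : ∀ n ∈ s, ‖b n‖ ≤ t := by
    intro n hn
    by_contra! h
    have h1 := hw1 n (‖b n‖ / t) ((one_lt_div ht).2 h)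
    have h2 := modular_lt_one_of_norm_lt hP _ hlt
    rw [hmod t ht] at h2
    exact absurd ((h1.trans (Finset.single_le_sum (f := fun n => w n (‖b n‖ / t))
      (fun _ _ => zero_le) hn)).trans_lt h2) (lt_irrefl _)
  have hAt : A = K * t := by rw [htdef]; field_simp
  by_cases hq' : q = ∞
  · subst hq'
    have := norm_sum_smul_unitVector_top_le s b ht.le hbt
    nlinarith
  · have h2t : 0 < 2 * t := by positivity
    have h2 := modular_lt_one_of_norm_lt hP _ (hlt.trans (by linarith : t < 2 * t))
    rw [hmod _ h2t] at h2
    have h3 : ∑ n ∈ s, potential q (ENNReal.ofReal (‖b n‖ / (2 * t))) ≤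
        1 + ENNReal.ofReal (1 / 4) := by
      refine (Finset.sum_le_sum fun n hn => hw n _ (by positivity) ?_).trans ?_
      · rw [div_le_div_iff₀ h2t two_pos]
        linarith [hbt n hn]
      · rw [Finset.sum_add_distrib]
        exact add_le_add h2.le (sum_ofReal_geometric_le s)
    -- The `ℓ_q` modular at level `2t` is `(K / 2) ^ q ≥ 2`, against the upper bound `1 + 1 / 4`.
    have e : A / (2 * t) = K / 2 := by rw [hAt]; field_simp
    rw [sum_potential_div hq hq' s b h2t, ← hAdef, e, ← ENNReal.ofReal_one,
      ← ENNReal.ofReal_add (by norm_num) (by norm_num),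
      ENNReal.ofReal_le_ofReal_iff (by norm_num)] at h3
    linarith [hK hq']

theorem exists_equivalentSequences_of_mem_essentialRange [SigmaFinite μ]
    (hP : 0 < lowerExponent P μ) (hq : 0 < q) (hμ : IsNonatomic μ) (hqR : q ∈ essentialRange P μ) :
    ∃ x : ℕ → VarLp 𝕜 P μ, DisjointlySupported x ∧
      EquivalentSequences 𝕜 x (unitVector 𝕜 q) := by
  rw [mem_essentialRange_iff] at hqR
  have hV := fun n : ℕ => hqR _ (eventually_potential_close hq
    (by positivity : (0 : ℝ) < 1 / 8 * (1 / 2) ^ n))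
  choose V hVsub hVm hV0 using hV
  obtain ⟨E, hEV, hE, hE0, hEfin, hdisj⟩ :=
    hμ.exists_pairwise_disjoint (fun n => P.measurable (hVm n)) hV0
  have hx := disjointlySupported_block (𝕜 := 𝕜) (P := P) hE hE0 hEfin hdisj
  refine ⟨_, hx, ?_⟩
  set x := fun n => block 𝕜 P μ (hE n) (hE0 n) (hEfin n) with hxdef
  let w : ℕ → ℝ → ℝ≥0∞ := fun n y =>
    (∫⁻ ω in E n, potential (P.toFun ω) (ENNReal.ofReal y) ∂μ) * (μ (E n))⁻¹
  have hclose : ∀ n, ∀ ω ∈ E n, ∀ y : ℝ, 0 ≤ y → y ≤ 1 / 2 → _ :=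
    fun n ω hω => hVsub n (hEV n hω)
  have hmod : ∀ (s : Finset ℕ) (b : ℕ → 𝕜) (t : ℝ), 0 < t →
      modular P μ (fun ω => ‖((∑ n ∈ s, b n • x n : VarLp 𝕜 P μ) : Ω →ₘ[μ] 𝕜) ω‖ₑ /
        ENNReal.ofReal t) = ∑ n ∈ s, w n (‖b n‖ / t) := by
    intro s b t ht
    rw [hx.modular_sum Measure.AbsolutelyContinuous.rfl]
    exact Finset.sum_congr rfl fun n _ => modular_smul_block _ _ _ _ ht
  have hwle : ∀ n y, 0 ≤ y → y ≤ 1 / 2 →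
      w n y ≤ potential q (ENNReal.ofReal y) + ENNReal.ofReal (1 / 8 * (1 / 2) ^ n) :=
    fun n y h0 h1 => setLIntegral_mul_inv_le (hE n) (hE0 n) (hEfin n)
      fun ω hω => (hclose n ω hω y h0 h1).1
  have hlew : ∀ n y, 0 ≤ y → y ≤ 1 / 2 →
      potential q (ENNReal.ofReal y) ≤ w n y + ENNReal.ofReal (1 / 8 * (1 / 2) ^ n) :=
    -- The error is moved to the left by truncated subtraction, so that the integrand is bounded
    -- below by a constant.
    fun n y h0 h1 => tsub_le_iff_right.1 (le_setLIntegral_mul_inv (hE n) (hE0 n) (hEfin n)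
      fun ω hω => tsub_le_iff_right.2 (hclose n ω hω y h0 h1).2)
  have hw1 : ∀ n y, 1 < y → 1 ≤ w n y :=
    fun n y hy => le_setLIntegral_mul_inv (hE n) (hE0 n) (hEfin n)
      fun ω _ => one_le_potential _ (ENNReal.one_lt_ofReal.2 hy)
  -- The factor `2 ^ (1 / q)` gives `(K / 2) ^ q ≥ 2` for finite `q`; for `q = ∞` it is `1`.
  set K : ℝ := 4 * 2 ^ (q.toReal)⁻¹ with hKdef
  have h2 : (1 : ℝ) ≤ 2 ^ (q.toReal)⁻¹ :=
    Real.one_le_rpow one_le_two (inv_nonneg.2 ENNReal.toReal_nonneg)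
  have hK4 : 4 ≤ K := by linarith
  have hK2 : q ≠ ∞ → 2 ≤ (K / 2) ^ q.toReal := by
    intro hq'
    have hq0 := ENNReal.toReal_pos hq.ne' hq'
    calc (2 : ℝ) = (2 ^ (q.toReal)⁻¹) ^ q.toReal := (Real.rpow_inv_rpow two_pos.le hq0.ne').symm
      _ ≤ (K / 2) ^ q.toReal := by
        refine Real.rpow_le_rpow (by positivity) ?_ hq0.le
        linarith
  have hK : q ≠ ∞ → 2 ≤ K ^ q.toReal := fun hq' => (hK2 hq').trans
    (Real.rpow_le_rpow (by positivity) (by linarith) ENNReal.toReal_nonneg)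
  refine ⟨K⁻¹, K, by positivity, by positivity, fun a => ?_⟩
  rcases eq_or_ne a 0 with rfl | ha
  · simp only [Finsupp.sum_zero_index]
    rw [VarLp.norm_zero, lp.norm_zero]
    simp
  · have hA : 0 < ‖∑ n ∈ a.support, a n • unitVector 𝕜 q n‖ := by
      obtain ⟨n, hn⟩ := Finsupp.support_nonempty_iff.2 ha
      exact (norm_pos_iff.2 (Finsupp.mem_support_iff.1 hn)).trans_le
        (norm_le_norm_sum_smul_unitVector hq a.support a hn)
    exact ⟨le_norm_sum_of_modular_close hP hq hK4 hK2 a.support a (hmod _ _) hlew hw1 hA,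
      norm_sum_le_of_modular_close hq hK4 hK a.support a (hmod _ _) hwle hA⟩

end Sufficiency

end VarLebesgue

theorem mainTheorem10 {𝕜 : Type*} [RCLike 𝕜] {Ω : Type*} [MeasurableSpace Ω]
    (μ : MeasureTheory.Measure Ω) [MeasureTheory.SigmaFinite μ]
    (P : VarLebesgue.VariableExponent Ω) (hP : 0 < VarLebesgue.lowerExponent P μ)
    (q : ℝ≥0∞) (hq : 0 < q) :
    ((∃ x : ℕ → VarLebesgue.VarLp 𝕜 P μ, VarLebesgue.DisjointlySupported x ∧
        VarLebesgue.EquivalentSequences 𝕜 x (VarLebesgue.unitVector 𝕜 q)) →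
      q ∈ VarLebesgue.essentialRange P μ) ∧
    (VarLebesgue.IsNonatomic μ →
      ((∃ x : ℕ → VarLebesgue.VarLp 𝕜 P μ, VarLebesgue.DisjointlySupported x ∧
          VarLebesgue.EquivalentSequences 𝕜 x (VarLebesgue.unitVector 𝕜 q)) ↔
        q ∈ VarLebesgue.essentialRange P μ)) := by
  have key : (∃ x : ℕ → VarLebesgue.VarLp 𝕜 P μ, VarLebesgue.DisjointlySupported x ∧
        VarLebesgue.EquivalentSequences 𝕜 x (VarLebesgue.unitVector 𝕜 q)) →
      q ∈ VarLebesgue.essentialRange P μ := fun ⟨_, hx, hxq⟩ =>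
    VarLebesgue.mem_essentialRange_of_equivalentSequences hP hq hx hxq
  exact ⟨key, fun hμ => ⟨key,
    VarLebesgue.exists_equivalentSequences_of_mem_essentialRange hP hq hμ⟩⟩
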